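/- Let $\lambda$ be a limit ordinal and let $\mathcal{E}_\lambda$ be the set of elementary embeddings $j:\langle V_\lambda,\in\rangle\to\langle V_\lambda,\in\rangle$ other than the identity. For $j\in\mathcal{E}_\lambda$ let $\operatorname{crit} j$ be the least ordinal $\alpha<\lambda$ with $\alpha<j(\alpha)$, and let the critical sequence $\langle\kappa_i : i<\omega\rangle$ of $j$ be given by $\kappa_0=\operatorname{crit} j$ and $\kappa_{i+1}=j(\kappa_i)$. For $A\subseteq V_\lambda$ put $j\cdot A=\bigcup_{\alpha<\lambda} j(A\cap V_\alpha)$, and for $j,k:V_\lambda\to V_\lambda$ let the application $jk$ be the function whose graph is $j\cdot k$, where $k$ is identified with its graph. Define the right powers of $j$ by $j^{(0)}=j$ and $j^{(n+1)}=j^{(n)}j^{(n)}$. The inverse limit $k_0\circ k_1\circ k_2\circ\cdots$ of a sequence $\langle k_n : n<\omega\rangle$ of embeddings in $\mathcal{E}_\lambda$ is the function that sends each $a\in V_{\bar\lambda}$, where $\bar\lambda=\liminf_{n<\omega}\operatorname{crit} k_n$, to $(k_0\circ k_1\circ\cdots\circ k_n)(a)$ for any $n$ large enough that $k_m(a)=a$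 for all $m>n$. Suppose that $j\in\mathcal{E}_\lambda$ has critical sequence $\langle\kappa_i : i<\omega\rangle$, and let $k=j\circ j^{(1)}\circ j^{(2)}\circ\cdots$ be the inverse limit of the right powers of $j$. Then all these objects are well defined: each $j^{(n)}$ moves some ordinal upwards and so has a critical point, every $\kappa_n$ is below $\lambda$, each set $j^{(n)}\cdot j^{(n)}$ is the graph of a function $V_\lambda\to V_\lambda$, and every element of the domain of $k$ is fixed by $j^{(m)}$ for all sufficiently large $m$. Moreover, every ordinal below $\lambda$ in the range of $k$ is either less than $\kappa_0$ or contained in an odd interval of the critical sequence of $j$: $$\operatorname{rng} k\cap\lambda\subseteq[0,\kappa_0)\cup\bigcup_{n<\omega}[\kappa_{2n+1},\kappa_{2n+2}).$$ -/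

import Mathlib

open scoped ZFSet

universe u

namespace RankToRank

/-- The relation symbols of the language of set theory: one binary symbol. -/
inductive SetRel : ℕ → Type
  | mem : SetRel 2

/-- The first-order language `{∈}` of set theory. -/
def setLang : FirstOrder.Language := ⟨fun _ => Empty, SetRel⟩

/-- The rank initial segment `V_lam` of the universe of sets, as a type. -/
abbrev Level (lam : Ordinal.{u}) : Type (u + 1) := {x : ZFSet.{u} // x ∈ V_ lam}

/-- `V_lam` as the structure `⟨V_lam, ∈⟩`. -/
instance levelStructure (lam : Ordinal.{u}) : setLang.Structure (Level lam) where
  funMap f := f.elim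
  RelMap | .mem => fun x => (x 0).1 ∈ (x 1).1

/-- The set `E_lam` of rank-to-rank embeddings: elementary embeddings of `⟨V_lam, ∈⟩` into
itself, in the full first-order language, that are not the identity. -/
def rankEmbeddings (lam : Ordinal.{u}) : Set (Level lam → Level lam) :=
  {j | (∃ e : setLang.ElementaryEmbedding (Level lam) (Level lam), ∀ x, e x = j x) ∧ j ≠ id}

theorem toZFSet_mem_level {lam α : Ordinal.{u}} (h : α < lam) : α.toZFSet ∈ V_ lam := by
  rw [ZFSet.mem_vonNeumann, Ordinal.rank_toZFSet]; exact h

/-- An ordinal `α < lam` as an element of `V_lam`. -/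
noncomputable def ordElem {lam : Ordinal.{u}} (α : Set.Iio lam) : Level lam :=
  ⟨α.1.toZFSet, toZFSet_mem_level α.2⟩

/-- The value `j(α)` at an ordinal `α < lam`, as an ordinal (an elementary `j` sends ordinals to
ordinals, and the rank of the von Neumann ordinal `j(α)` is that ordinal). -/
noncomputable def ordValue {lam : Ordinal.{u}} (j : Level lam → Level lam) (α : Set.Iio lam) :
    Ordinal.{u} :=
  (j (ordElem α)).1.rank

/-- The ordinals `α < lam` with `α < j(α)`. -/
def movedOrdinals {lam : Ordinal.{u}} (j : Level lam → Level lam) : Set Ordinal.{u} :=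
  {α | ∃ h : α < lam, α < ordValue j ⟨α, h⟩}

/-- The critical point of `j`: the least ordinal `α` with `α < j(α)`. -/
noncomputable def crit {lam : Ordinal.{u}} (j : Level lam → Level lam) : Ordinal.{u} :=
  sInf (movedOrdinals j)

open Classical in
/-- The critical sequence of `j`: `κ_0` is the critical point and `κ_{n+1} = j(κ_n)`. -/
noncomputable def critSeq {lam : Ordinal.{u}} (j : Level lam → Level lam) : ℕ → Ordinal.{u}
  | 0 => crit j
  | n + 1 => if h : critSeq j n < lam then ordValue j ⟨critSeq j n, h⟩ else 0

theorem inter_mem_level {lam : Ordinal.{u}} (A : ZFSet.{u}) (α : Set.Iio lam) :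
    A ∩ V_ α.1 ∈ V_ lam := by
  rw [ZFSet.mem_vonNeumann]
  refine lt_of_le_of_lt ?_ α.2
  rw [← ZFSet.subset_vonNeumann]
  intro x hx
  exact (ZFSet.mem_inter.1 hx).2

/-- The extension of `j` to subsets of `V_lam`:
`j · A` is the union of the sets `j (A ∩ V_α)` over all `α < lam`. -/
noncomputable def extend {lam : Ordinal.{u}} (j : Level lam → Level lam) (A : ZFSet.{u}) :
    ZFSet.{u} :=
  ZFSet.iUnion fun α : Set.Iio lam => (j ⟨A ∩ V_ α.1, inter_mem_level A α⟩).1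

/-- The graph of `k`, a subset of `V_lam`: the set of all ordered pairs `⟨x, k x⟩`. -/
noncomputable def graph {lam : Ordinal.{u}} (k : Level lam → Level lam) : ZFSet.{u} :=
  ZFSet.range fun x : Level lam => ZFSet.pair x.1 (k x).1

open Classical in
/-- The application `j k` of `j` to `k`: the function whose graph is `j · (graph of k)`. -/
noncomputable def app {lam : Ordinal.{u}} (j k : Level lam → Level lam) :
    Level lam → Level lam := fun x =>
  if h : ∃ y : Level lam, ZFSet.pair x.1 y.1 ∈ extend j (graph k) then h.choose else x

/-- The right powers of `j`: `j^(0) = j` and `j^(n+1) = j^(n) j^(n)`. -/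
noncomputable def rightPower {lam : Ordinal.{u}} (j : Level lam → Level lam) :
    ℕ → Level lam → Level lam
  | 0 => j
  | n + 1 => app (rightPower j n) (rightPower j n)

/-- The finite composite `k_0 ∘ k_1 ∘ ⋯ ∘ k_n`. -/
def composite {lam : Ordinal.{u}} (k : ℕ → Level lam → Level lam) : ℕ → Level lam → Level lam
  | 0 => k 0
  | n + 1 => composite k n ∘ k (n + 1)

/-- The height of the domain of the inverse limit: the limit inferior of the critical points. -/
noncomputable def limitHeight {lam : Ordinal.{u}} (k : ℕ → Level lam → Level lam) :
    Ordinal.{u} :=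
  Filter.liminf (fun n => crit (k n)) Filter.atTop

/-- The domain of the inverse limit: the elements of `V_lam` that lie in `V_μ`, where `μ ≤ lam` is
the limit inferior of the critical points. -/
abbrev LimitDomain {lam : Ordinal.{u}} (k : ℕ → Level lam → Level lam) : Type (u + 1) :=
  {a : Level lam // a.1 ∈ V_ (limitHeight k)}

/-- The inverse limit `k_0 ∘ k_1 ∘ k_2 ∘ ⋯`: at `a` it is `(k_0 ∘ ⋯ ∘ k_n) a`, where `n` is large
enough that `k_m a = a` for all `m > n` (the least such `n` is taken). -/
noncomputable def inverseLimit {lam : Ordinal.{u}} (k : ℕ → Level lam → Level lam)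
    (a : LimitDomain k) : Level lam :=
  composite k (sInf {n : ℕ | ∀ m > n, k m a.1 = a.1}) a.1

end RankToRank

/-!
Comparison of ranks in `V_lam` is first-order definable, because `rank x ≤ rank y` holds if and
only if some relation simulates `x` by `y`. Elementary embeddings therefore respect ranks and can
be studied through their effect on the rank of a set. Definable facts about the elements of `A`
transfer to `j · A`; applied to the graph of `k`, this makes `j k` elementary, with
`(j k) (j x) = j (k x)`. Hence the critical sequence of `j k` is the image under `j` of that of
`k`, and the critical sequence of `j^(n)` is that of `j` shifted by `n`.

A set with rank in `[κ_n, κ_{n+1})` is fixed by `j^(m)` for `m > n`, so `k` acts on it as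
`j ∘ j^(1) ∘ ⋯ ∘ j^(n)`. Each of these `n + 1` maps moves the rank up by one interval of the
critical sequence, from the `n`-th interval to the `(2 * n + 1)`-st.
-/

namespace RankToRank

section Definability

variable {L : FirstOrder.Language} {M : Type*} [L.Structure M] {α β : Type*}

/-- Definability without parameters, for a predicate on assignments of the variables `α`: the
predicate form of `Set.Definable`, in which statements with quantifiers can be written directly. -/
def DefinablePred (L : FirstOrder.Language) {M : Type*} [L.Structure M] {α : Type*}
    (P : (α → M) → Prop) : Prop :=
  (∅ : Set M).Definable L {v | P v}

theorem definablePred_iff_exists_formula {P : (α → M) → Prop} :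
    DefinablePred L P ↔ ∃ φ : L.Formula α, ∀ v, φ.Realize v ↔ P v :=
  Set.empty_definable_iff.trans <| exists_congr fun _ =>
    Set.ext_iff.trans <| forall_congr' fun _ => Iff.comm

theorem definablePred_realize (φ : L.Formula α) :
    DefinablePred L fun v : α → M => φ.Realize v :=
  definablePred_iff_exists_formula.2 ⟨φ, fun _ => Iff.rfl⟩

namespace DefinablePred

variable {P Q : (α → M) → Prop}

theorem congr (hP : DefinablePred L P) (h : ∀ v, Q v ↔ P v) : DefinablePred L Q := by
  rwa [show Q = P from funext fun v => propext (h v)]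

theorem comp (hP : DefinablePred L P) (g : α → β) :
    DefinablePred L fun w : β → M => P (w ∘ g) :=
  Set.Definable.preimage_comp g hP

theorem and (hP : DefinablePred L P) (hQ : DefinablePred L Q) :
    DefinablePred L fun v => P v ∧ Q v :=
  Set.Definable.inter hP hQ

theorem or (hP : DefinablePred L P) (hQ : DefinablePred L Q) :
    DefinablePred L fun v => P v ∨ Q v :=
  Set.Definable.union hP hQ

theorem not (hP : DefinablePred L P) : DefinablePred L fun v => ¬P v :=
  Set.Definable.compl hP

theorem imp (hP : DefinablePred L P) (hQ : DefinablePred L Q) :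
    DefinablePred L fun v => P v → Q v :=
  (hP.not.or hQ).congr fun _ => imp_iff_not_or

theorem iff (hP : DefinablePred L P) (hQ : DefinablePred L Q) :
    DefinablePred L fun v => P v ↔ Q v :=
  ((hP.imp hQ).and (hQ.imp hP)).congr fun _ => iff_iff_implies_and_implies

theorem forall_finite [Finite β] {P : β → (α → M) → Prop} (hP : ∀ b, DefinablePred L (P b)) :
    DefinablePred L fun v => ∀ b, P b v :=
  DefinablePred.congr (P := (· ∈ ⋂ b, {v | P b v})) (Set.definable_iInter_of_finite hP)
    fun _ => Set.mem_iInter.symm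

theorem forall_tuple [Finite β] {P : (α → M) → (β → M) → Prop}
    (hP : DefinablePred L fun w : α ⊕ β → M => P (w ∘ Sum.inl) (w ∘ Sum.inr)) :
    DefinablePred L fun v => ∀ x, P v x :=
  Set.Definable.forall_of_finite hP

theorem all {P : (α → M) → M → Prop}
    (hP : DefinablePred L fun w : α ⊕ Unit → M => P (w ∘ Sum.inl) (w (Sum.inr ()))) :
    DefinablePred L fun v => ∀ x, P v x :=
  (forall_tuple (P := fun v x => P v (x ())) hP).congr fun _ =>
    ⟨fun h x => h (x ()), fun h x => h fun _ => x⟩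

theorem ex {P : (α → M) → M → Prop}
    (hP : DefinablePred L fun w : α ⊕ Unit → M => P (w ∘ Sum.inl) (w (Sum.inr ()))) :
    DefinablePred L fun v => ∃ x, P v x :=
  (all (P := fun v x => ¬P v x) hP.not).not.congr fun _ => by push Not; rfl

end DefinablePred

theorem definablePred_eq (i k : α) : DefinablePred L fun v : α → M => v i = v k :=
  DefinablePred.congr (definablePred_realize ((FirstOrder.Language.Term.var i).equal (.var k)))
    fun _ => by simp only [FirstOrder.Language.Formula.realize_equal,
      FirstOrder.Language.Term.realize_var]

/-- Elementarity of a self-map of a structure, as a property of the bare function. -/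
def IsElementary (L : FirstOrder.Language) {M : Type*} [L.Structure M] (j : M → M) : Prop :=
  ∃ e : L.ElementaryEmbedding M M, ∀ x, e x = j x

theorem IsElementary.iff {j : M → M} (hj : IsElementary L j) {P : (α → M) → Prop}
    (hP : DefinablePred L P) (v : α → M) : P (j ∘ v) ↔ P v := by
  obtain ⟨e, he⟩ := hj
  obtain ⟨φ, hφ⟩ := definablePred_iff_exists_formula.1 hP
  rw [← hφ, ← hφ, ← show ⇑e = j from funext he, e.map_formula]

end Definability

section Rank

theorem rank_orderedPair (x y : ZFSet.{u}) :
    (ZFSet.pair x y).rank = Order.succ (Order.succ (max x.rank y.rank)) := by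
  simp only [ZFSet.pair, ZFSet.rank_pair, ZFSet.rank_singleton, Order.succ_max,
    max_eq_right (le_max_left _ _)]

theorem rank_orderedPair_mono {x y x' y' : ZFSet.{u}} (hx : x.rank ≤ x'.rank)
    (hy : y.rank ≤ y'.rank) : (ZFSet.pair x y).rank ≤ (ZFSet.pair x' y').rank := by
  rw [rank_orderedPair, rank_orderedPair]
  gcongr

variable {lam : Ordinal.{u}}

theorem rank_lt (x : Level lam) : x.1.rank < lam :=
  ZFSet.mem_vonNeumann.1 x.2

theorem orderedPair_mem_level (hlam : Order.IsSuccLimit lam) (x y : Level lam) :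
    ZFSet.pair x.1 y.1 ∈ V_ lam := by
  rw [ZFSet.mem_vonNeumann, rank_orderedPair]
  exact hlam.succ_lt (hlam.succ_lt (max_lt (rank_lt x) (rank_lt y)))

theorem rank_ordElem (α : Set.Iio lam) : (ordElem α).1.rank = α.1 :=
  Ordinal.rank_toZFSet _

theorem mem_level_of_mem {x y : ZFSet.{u}} (hxy : x ∈ y) (hy : y ∈ V_ lam) : x ∈ V_ lam :=
  (ZFSet.isTransitive_vonNeumann lam).mem_trans hxy hy

theorem level_ext {x y : Level lam} (h : ∀ z : Level lam, z.1 ∈ x.1 ↔ z.1 ∈ y.1) : x = y :=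
  Subtype.ext <| ZFSet.ext fun z =>
    ⟨fun hz => (h ⟨z, mem_level_of_mem hz x.2⟩).1 hz,
      fun hz => (h ⟨z, mem_level_of_mem hz y.2⟩).2 hz⟩

/-- The set `A ∩ V_δ` as an element of `V_lam`; these sets approximate `A` in the definition of
`extend`. -/
noncomputable def trunc (A : ZFSet.{u}) (δ : Set.Iio lam) : Level lam :=
  ⟨A ∩ V_ δ.1, inter_mem_level A δ⟩

theorem mem_trunc {A p : ZFSet.{u}} {δ : Set.Iio lam} :
    p ∈ (trunc A δ).1 ↔ p ∈ A ∧ p.rank < δ.1 := by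
  rw [trunc, ZFSet.mem_inter, ZFSet.mem_vonNeumann]

theorem trunc_mono (A : ZFSet.{u}) {δ ε : Set.Iio lam} (h : δ ≤ ε) :
    (trunc A δ).1 ⊆ (trunc A ε).1 := fun _ hp =>
  mem_trunc.2 ⟨(mem_trunc.1 hp).1, (mem_trunc.1 hp).2.trans_le h⟩

-- `s` is a simulation of `∈` by `∈`; unlike rank, simulations are defined without recursion.
theorem rank_le_iff_exists_simulation (hlam : Order.IsSuccLimit lam) {x y : Level lam} :
    x.1.rank ≤ y.1.rank ↔ ∃ s : Level lam, ZFSet.pair x.1 y.1 ∈ s.1 ∧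
      ∀ a b : Level lam, ZFSet.pair a.1 b.1 ∈ s.1 → ∀ a' : Level lam, a'.1 ∈ a.1 →
        ∃ b' : Level lam, b'.1 ∈ b.1 ∧ ZFSet.pair a'.1 b'.1 ∈ s.1 := by
  constructor
  · intro hxy
    let δ : Set.Iio lam := ⟨Order.succ (ZFSet.pair x.1 y.1).rank,
      hlam.succ_lt (rank_lt ⟨_, orderedPair_mem_level hlam x y⟩)⟩
    let s : Level lam :=
      trunc (ZFSet.pairSep (fun a b => a.rank ≤ b.rank) (V_ lam) (V_ lam)) δ
    have mem_s (a b : Level lam) : ZFSet.pair a.1 b.1 ∈ s.1 ↔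
        a.1.rank ≤ b.1.rank ∧ (ZFSet.pair a.1 b.1).rank < δ.1 := by
      simp [s, mem_trunc, a.2, b.2]
    refine ⟨s, (mem_s x y).2 ⟨hxy, Order.lt_succ _⟩, fun a b hab a' ha' => ?_⟩
    obtain ⟨hle, hδ⟩ := (mem_s a b).1 hab
    obtain ⟨b', hb', hle'⟩ := ZFSet.lt_rank_iff.1 ((ZFSet.rank_lt_of_mem ha').trans_le hle)
    refine ⟨⟨b', mem_level_of_mem hb' b.2⟩, hb', (mem_s _ _).2 ⟨hle', hδ.trans_le' ?_⟩⟩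
    exact rank_orderedPair_mono (ZFSet.rank_lt_of_mem ha').le (ZFSet.rank_lt_of_mem hb').le
  · rintro ⟨s, hxy, hs⟩
    obtain ⟨x, hx⟩ := x
    induction x using ZFSet.inductionOn generalizing y with
    | _ x ih =>
      refine ZFSet.rank_le_iff.2 fun a ha => ?_
      obtain ⟨b, hb, hab⟩ := hs _ _ hxy ⟨a, mem_level_of_mem ha hx⟩ ha
      exact (ih a ha _ hab).trans_lt (ZFSet.rank_lt_of_mem hb)

end Rank

section SetTheoreticFormulas

variable {lam : Ordinal.{u}} {α : Type*}

theorem definablePred_mem (i k : α) :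
    DefinablePred setLang fun v : α → Level lam => (v i).1 ∈ (v k).1 :=
  (definablePred_realize (FirstOrder.Language.Relations.formula₂ (L := setLang) SetRel.mem
    (.var i) (.var k))).congr fun _ => Iff.symm <| by
      exact FirstOrder.Language.Formula.realize_rel₂

theorem definablePred_subset (i k : α) :
    DefinablePred setLang fun v : α → Level lam => (v i).1 ⊆ (v k).1 :=
  DefinablePred.congr (P := fun v => ∀ z : Level lam, z.1 ∈ (v i).1 → z.1 ∈ (v k).1)
    (.all <| .imp (definablePred_mem _ _) (definablePred_mem _ _)) fun v =>
      ⟨fun h _ hz => h hz, fun h z hz => h ⟨z, mem_level_of_mem hz (v i).2⟩ hz⟩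

theorem definablePred_eq_unorderedPair (i k m : α) :
    DefinablePred setLang fun v : α → Level lam => (v m).1 = {(v i).1, (v k).1} := by
  refine DefinablePred.congr
    (P := fun v => ∀ z : Level lam, z.1 ∈ (v m).1 ↔ z = v i ∨ z = v k)
    (.all <| .iff (definablePred_mem _ _) (.or (definablePred_eq _ _) (definablePred_eq _ _)))
    fun v => ⟨fun h z => ?_, fun h => ?_⟩
  · rw [h, ZFSet.mem_pair, Subtype.ext_iff, Subtype.ext_iff]
  · ext z
    rw [ZFSet.mem_pair]
    constructor
    · intro hz
      simpa only [Subtype.ext_iff] using (h ⟨z, mem_level_of_mem hz (v m).2⟩).1 hz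
    · rintro (rfl | rfl)
      · exact (h _).2 (Or.inl rfl)
      · exact (h _).2 (Or.inr rfl)

theorem definablePred_eq_orderedPair (i k m : α) :
    DefinablePred setLang fun v : α → Level lam => (v m).1 = ZFSet.pair (v i).1 (v k).1 := by
  refine DefinablePred.congr
    (P := fun v => ∃ s t : Level lam, s.1 = {(v i).1, (v i).1} ∧ t.1 = {(v i).1, (v k).1} ∧
      (v m).1 = {s.1, t.1})
    (.ex <| .ex <| .and (definablePred_eq_unorderedPair _ _ _) <|
      .and (definablePred_eq_unorderedPair _ _ _) (definablePred_eq_unorderedPair _ _ _))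
    fun v => ⟨fun h => ?_, ?_⟩
  · have hs : ({(v i).1, (v i).1} : ZFSet) ∈ (v m).1 := by simp [h, ZFSet.pair]
    have ht : ({(v i).1, (v k).1} : ZFSet) ∈ (v m).1 := by simp [h, ZFSet.pair]
    exact ⟨⟨_, mem_level_of_mem hs (v m).2⟩, ⟨_, mem_level_of_mem ht (v m).2⟩, rfl, rfl,
      by simp only [h, ZFSet.pair, ZFSet.pair_eq_singleton]⟩
  · rintro ⟨s, t, hs, ht, h⟩
    rw [h, hs, ht, ZFSet.pair, ZFSet.pair_eq_singleton]

theorem definablePred_orderedPair_mem (i k m : α) :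
    DefinablePred setLang fun v : α → Level lam => ZFSet.pair (v i).1 (v k).1 ∈ (v m).1 :=
  DefinablePred.congr
    (P := fun v => ∃ p : Level lam, p.1 = ZFSet.pair (v i).1 (v k).1 ∧ p.1 ∈ (v m).1)
    (.ex <| .and (definablePred_eq_orderedPair _ _ _) (definablePred_mem _ _)) fun v =>
      ⟨fun h => ⟨⟨_, mem_level_of_mem h (v m).2⟩, rfl, h⟩, fun ⟨_, hp, h⟩ => hp ▸ h⟩

theorem definablePred_rank_le (hlam : Order.IsSuccLimit lam) (i k : α) :
    DefinablePred setLang fun v : α → Level lam => (v i).1.rank ≤ (v k).1.rank := by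
  refine DefinablePred.congr (.ex <| .and (definablePred_orderedPair_mem _ _ _) <|
    .all <| .all <| .imp (definablePred_orderedPair_mem _ _ _) <| .all <|
      .imp (definablePred_mem _ _) <| .ex <| .and (definablePred_mem _ _)
        (definablePred_orderedPair_mem _ _ _)) fun v => rank_le_iff_exists_simulation hlam

theorem definablePred_rank_lt (hlam : Order.IsSuccLimit lam) (i k : α) :
    DefinablePred setLang fun v : α → Level lam => (v i).1.rank < (v k).1.rank :=
  (definablePred_rank_le hlam k i).not.congr fun _ => not_le.symm

end SetTheoreticFormulas

namespace IsElementary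

variable {lam : Ordinal.{u}} {j : Level lam → Level lam} (hj : IsElementary setLang j)

include hj

theorem mem_iff (x y : Level lam) : (j x).1 ∈ (j y).1 ↔ x.1 ∈ y.1 :=
  hj.iff (definablePred_mem 0 1) ![x, y]

theorem subset_iff (x y : Level lam) : (j x).1 ⊆ (j y).1 ↔ x.1 ⊆ y.1 :=
  hj.iff (definablePred_subset 0 1) ![x, y]

theorem eq_orderedPair_iff (p x y : Level lam) :
    (j p).1 = ZFSet.pair (j x).1 (j y).1 ↔ p.1 = ZFSet.pair x.1 y.1 :=
  hj.iff (definablePred_eq_orderedPair 0 1 2) ![x, y, p]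

theorem rank_lt_iff (hlam : Order.IsSuccLimit lam) (x y : Level lam) :
    (j x).1.rank < (j y).1.rank ↔ x.1.rank < y.1.rank :=
  hj.iff (definablePred_rank_lt hlam 0 1) ![x, y]

theorem rank_le_iff (hlam : Order.IsSuccLimit lam) (x y : Level lam) :
    (j x).1.rank ≤ (j y).1.rank ↔ x.1.rank ≤ y.1.rank :=
  hj.iff (definablePred_rank_le hlam 0 1) ![x, y]

theorem rank_congr (hlam : Order.IsSuccLimit lam) {x y : Level lam} (h : x.1.rank = y.1.rank) :
    (j x).1.rank = (j y).1.rank :=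
  ((hj.rank_le_iff hlam x y).2 h.le).antisymm ((hj.rank_le_iff hlam y x).2 h.ge)

theorem rank_le_rank_map (x : Level lam) : x.1.rank ≤ (j x).1.rank := by
  obtain ⟨x, hx⟩ := x
  induction x using ZFSet.inductionOn with
  | _ x ih =>
    refine ZFSet.rank_le_iff.2 fun y hy => ?_
    have hjy := (hj.mem_iff ⟨y, mem_level_of_mem hy hx⟩ ⟨x, hx⟩).2 hy
    exact (ih y hy _).trans_lt (ZFSet.rank_lt_of_mem hjy)

theorem map_eq_self_of_forall_rank_map {γ : Ordinal.{u}}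
    (h : ∀ x : Level lam, x.1.rank < γ → (j x).1.rank = x.1.rank) (x : Level lam)
    (hx : x.1.rank < γ) : j x = x := by
  induction hr : x.1.rank using WellFoundedLT.induction generalizing x with
  | _ o ih =>
    subst hr
    have fixed (y : Level lam) (hy : y.1.rank < x.1.rank) : j y = y :=
      ih _ hy y (hy.trans hx) rfl
    refine level_ext fun y => ⟨fun hy => ?_, fun hy => ?_⟩
    · rwa [← fixed y (h x hx ▸ ZFSet.rank_lt_of_mem hy), hj.mem_iff] at hy
    · rwa [← fixed y (ZFSet.rank_lt_of_mem hy), hj.mem_iff]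

end IsElementary

section Extension

variable {lam : Ordinal.{u}} {j : Level lam → Level lam} {A : ZFSet.{u}}

theorem mem_extend {p : ZFSet.{u}} : p ∈ extend j A ↔ ∃ δ : Set.Iio lam, p ∈ (j (trunc A δ)).1 :=
  ZFSet.mem_iUnion

theorem mem_level_of_mem_extend {p : ZFSet.{u}} (hp : p ∈ extend j A) : p ∈ V_ lam :=
  let ⟨_, h⟩ := mem_extend.1 hp
  mem_level_of_mem h (Subtype.property _)

variable (hlam : Order.IsSuccLimit lam) (hj : IsElementary setLang j)

include hlam hj

theorem map_mem_extend {p : Level lam} (hp : p.1 ∈ A) : (j p).1 ∈ extend j A :=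
  mem_extend.2 ⟨⟨Order.succ p.1.rank, hlam.succ_lt (rank_lt p)⟩,
    (hj.mem_iff _ _).2 <| mem_trunc.2 ⟨hp, Order.lt_succ _⟩⟩

theorem forall_mem_extend {ι : Type*} [Finite ι] {P : (ι → Level lam) → Prop}
    (hP : DefinablePred setLang P)
    (hA : ∀ p : ι → Level lam, (∀ i, (p i).1 ∈ A) → P p) {p : ι → Level lam}
    (hp : ∀ i, (p i).1 ∈ extend j A) : P p := by
  choose δ hδ using fun i => mem_extend.1 (hp i)
  have : Nonempty (Set.Iio lam) := ⟨⟨0, hlam.bot_lt⟩⟩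
  obtain ⟨ε, hε⟩ := Finite.exists_le δ
  have definable : DefinablePred setLang fun v : Fin 1 → Level lam =>
      ∀ p : ι → Level lam, (∀ i, (p i).1 ∈ (v 0).1) → P p :=
    .forall_tuple <| .imp (.forall_finite fun _ => definablePred_mem _ _) (hP.comp _)
  exact (hj.iff definable ![trunc A ε]).2 (fun p hp => hA p fun i => (mem_trunc.1 (hp i)).1) p
    fun i => (hj.subset_iff _ _).2 (trunc_mono A (hε i)) (hδ i)

theorem exists_mem_extend {P : Level lam → Level lam → Prop}
    (hP : DefinablePred setLang fun v : Fin 2 → Level lam => P (v 0) (v 1)) {b c : Level lam}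
    (h : ∀ x : Level lam, x.1.rank < b.1.rank →
      ∃ p : Level lam, p.1 ∈ A ∧ p.1.rank ≤ c.1.rank ∧ P x p)
    {x : Level lam} (hx : x.1.rank < (j b).1.rank) : ∃ p : Level lam, p.1 ∈ extend j A ∧ P x p := by
  have definable : DefinablePred setLang fun v : Fin 2 → Level lam =>
      ∀ x : Level lam, x.1.rank < (v 0).1.rank → ∃ p : Level lam, p.1 ∈ (v 1).1 ∧ P x p :=
    .all <| .imp (definablePred_rank_lt hlam _ _) <| .ex <| .and (definablePred_mem _ _)
      (hP.comp ![Sum.inl (Sum.inr ()), Sum.inr ()])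
  let δ : Set.Iio lam := ⟨Order.succ c.1.rank, hlam.succ_lt (rank_lt c)⟩
  have bounded (x : Level lam) (hx : x.1.rank < b.1.rank) :
      ∃ p : Level lam, p.1 ∈ (trunc A δ).1 ∧ P x p :=
    let ⟨p, hpA, hpc, hxp⟩ := h x hx
    ⟨p, mem_trunc.2 ⟨hpA, Order.lt_succ_of_le hpc⟩, hxp⟩
  obtain ⟨p, hp, hxp⟩ := (hj.iff definable ![b, trunc A δ]).2 bounded x hx
  exact ⟨p, mem_extend.2 ⟨δ, hp⟩, hxp⟩

end Extension

section Application

variable {lam : Ordinal.{u}} {j k : Level lam → Level lam}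

theorem orderedPair_mem_graph {x y : Level lam} : ZFSet.pair x.1 y.1 ∈ graph k ↔ k x = y := by
  simp only [graph, ZFSet.mem_range, ZFSet.pair_inj]
  constructor
  · rintro ⟨z, hzx, hzy⟩
    rw [← Subtype.ext hzx, Subtype.ext hzy]
  · rintro rfl
    exact ⟨x, rfl, rfl⟩

variable (hlam : Order.IsSuccLimit lam) (hj : IsElementary setLang j)

include hlam hj

theorem exists_eq_orderedPair_of_mem_extend_graph {p : ZFSet.{u}} (hp : p ∈ extend j (graph k)) :
    ∃ x y : Level lam, p = ZFSet.pair x.1 y.1 :=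
  forall_mem_extend hlam hj (ι := Unit) (p := fun _ => ⟨p, mem_level_of_mem_extend hp⟩)
    (P := fun v => ∃ x y : Level lam, (v ()).1 = ZFSet.pair x.1 y.1)
    (.ex <| .ex <| definablePred_eq_orderedPair _ _ _)
    (fun _ h => let ⟨x, hx⟩ := ZFSet.mem_range.1 (h ()); ⟨x, k x, hx.symm⟩) fun _ => hp

variable (hk : IsElementary setLang k)

include hk

theorem iff_of_orderedPair_mem_extend_graph {ι : Type*} [Finite ι]
    {P : (ι → Level lam) → Prop} (hP : DefinablePred setLang P) {a b : ι → Level lam}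
    (h : ∀ i, ZFSet.pair (a i).1 (b i).1 ∈ extend j (graph k)) : P b ↔ P a := by
  have definable : DefinablePred setLang fun p : ι → Level lam => ∀ a b : ι → Level lam,
      (∀ i, (p i).1 = ZFSet.pair (a i).1 (b i).1) → (P b ↔ P a) :=
    .forall_tuple <| .forall_tuple <| .imp
      (.forall_finite fun _ => definablePred_eq_orderedPair _ _ _)
      (.iff (hP.comp _) (hP.comp (Sum.inl ∘ Sum.inr)))
  refine forall_mem_extend hlam hj definable (fun p hp a b hab => ?_)
    (p := fun i => ⟨_, mem_level_of_mem_extend (h i)⟩) h a b fun _ => rfl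
  have : b = k ∘ a := funext fun i => (orderedPair_mem_graph.1 (hab i ▸ hp i)).symm
  rw [this, hk.iff hP]

theorem eq_of_orderedPair_mem_extend_graph {x y z : Level lam}
    (hy : ZFSet.pair x.1 y.1 ∈ extend j (graph k))
    (hz : ZFSet.pair x.1 z.1 ∈ extend j (graph k)) : y = z :=
  (iff_of_orderedPair_mem_extend_graph hlam hj hk (definablePred_eq 0 1) (a := ![x, x])
    (b := ![y, z]) (Fin.forall_fin_two.2 ⟨hy, hz⟩)).2 rfl

theorem exists_orderedPair_mem_extend_graph (x : Level lam) :
    ∃ y : Level lam, ZFSet.pair x.1 y.1 ∈ extend j (graph k) := by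
  let b : Level lam := ordElem ⟨Order.succ x.1.rank, hlam.succ_lt (rank_lt x)⟩
  have hxb : x.1.rank < b.1.rank := by
    rw [rank_ordElem]
    exact Order.lt_succ _
  obtain ⟨p, hp, y, hxy⟩ := exists_mem_extend hlam hj (A := graph k) (b := b)
    (c := ⟨_, orderedPair_mem_level hlam b (k b)⟩)
    (P := fun x p => ∃ y : Level lam, p.1 = ZFSet.pair x.1 y.1)
    (.ex <| definablePred_eq_orderedPair _ _ _)
    (fun x hx => ⟨⟨_, orderedPair_mem_level hlam x (k x)⟩, orderedPair_mem_graph.2 rfl,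
      rank_orderedPair_mono hx.le ((hk.rank_le_iff hlam x b).2 hx.le), k x, rfl⟩)
    (hxb.trans_le (hj.rank_le_rank_map b))
  exact ⟨y, hxy ▸ hp⟩

theorem orderedPair_app_mem_extend_graph (x : Level lam) :
    ZFSet.pair x.1 (app j k x).1 ∈ extend j (graph k) := by
  have h := exists_orderedPair_mem_extend_graph hlam hj hk x
  rw [app, dif_pos h]
  exact h.choose_spec

theorem app_eq_iff {x y : Level lam} : app j k x = y ↔ ZFSet.pair x.1 y.1 ∈ extend j (graph k) :=
  ⟨fun h => h ▸ orderedPair_app_mem_extend_graph hlam hj hk x,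
    eq_of_orderedPair_mem_extend_graph hlam hj hk (orderedPair_app_mem_extend_graph hlam hj hk x)⟩

theorem graph_app : graph (app j k) = extend j (graph k) := by
  ext p
  constructor
  · intro hp
    obtain ⟨x, rfl⟩ := ZFSet.mem_range.1 hp
    exact orderedPair_app_mem_extend_graph hlam hj hk x
  · intro hp
    obtain ⟨x, y, rfl⟩ := exists_eq_orderedPair_of_mem_extend_graph hlam hj hp
    exact orderedPair_mem_graph.2 ((app_eq_iff hlam hj hk).2 hp)

theorem IsElementary.app : IsElementary setLang (app j k) :=
  ⟨⟨RankToRank.app j k, fun _ φ x => iff_of_orderedPair_mem_extend_graph hlam hj hk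
    (definablePred_realize φ) fun i => orderedPair_app_mem_extend_graph hlam hj hk (x i)⟩,
    fun _ => rfl⟩

theorem app_map (x : Level lam) : app j k (j x) = j (k x) := by
  let p : Level lam := ⟨ZFSet.pair x.1 (k x).1, orderedPair_mem_level hlam x (k x)⟩
  have hp : (j p).1 ∈ extend j (graph k) := map_mem_extend hlam hj (orderedPair_mem_graph.2 rfl)
  rwa [(hj.eq_orderedPair_iff p x (k x)).2 rfl, ← app_eq_iff hlam hj hk] at hp

theorem app_eq_self {b : Level lam}
    (h : ∀ x : Level lam, x.1.rank < b.1.rank → k x = x) {x : Level lam}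
    (hx : x.1.rank < (j b).1.rank) : app j k x = x := by
  obtain ⟨p, hp, hxp⟩ := exists_mem_extend hlam hj (A := graph k) (b := b)
    (c := ⟨_, orderedPair_mem_level hlam b b⟩)
    (P := fun x p => p.1 = ZFSet.pair x.1 x.1) (definablePred_eq_orderedPair _ _ _)
    (fun x hx => ⟨⟨_, orderedPair_mem_level hlam x x⟩, orderedPair_mem_graph.2 (h x hx),
      rank_orderedPair_mono hx.le hx.le, rfl⟩)
    hx
  exact (app_eq_iff hlam hj hk).2 (hxp ▸ hp)

end Application

section CriticalSequence

variable {lam : Ordinal.{u}} {j k : Level lam → Level lam} (hlam : Order.IsSuccLimit lam)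

include hlam

theorem rank_mem_movedOrdinals_iff (hj : IsElementary setLang j) {x : Level lam} :
    x.1.rank ∈ movedOrdinals j ↔ x.1.rank < (j x).1.rank := by
  rw [hj.rank_congr hlam (rank_ordElem ⟨_, rank_lt x⟩).symm]
  exact exists_prop_of_true (rank_lt x)

theorem map_eq_self_of_forall_notMem_movedOrdinals (hj : IsElementary setLang j)
    {γ : Ordinal.{u}} (h : ∀ α < γ, α ∉ movedOrdinals j) {x : Level lam} (hx : x.1.rank < γ) :
    j x = x := by
  refine hj.map_eq_self_of_forall_rank_map (fun y hy => ?_) x hx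
  refine (hj.rank_le_rank_map y).antisymm' (not_lt.1 ?_)
  rw [← rank_mem_movedOrdinals_iff hlam hj]
  exact h _ hy

theorem isLeast_crit (hj : j ∈ rankEmbeddings lam) : IsLeast (movedOrdinals j) (crit j) := by
  refine ⟨csInf_mem <| Set.nonempty_iff_ne_empty.2 fun hempty => hj.2 <| funext fun x => ?_,
    fun _ => csInf_le'⟩
  refine map_eq_self_of_forall_notMem_movedOrdinals hlam hj.1 (fun α _ => ?_) (rank_lt x)
  exact hempty ▸ Set.notMem_empty α

theorem map_eq_self_of_rank_lt_crit (hj : IsElementary setLang j) {x : Level lam}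
    (hx : x.1.rank < crit j) : j x = x :=
  map_eq_self_of_forall_notMem_movedOrdinals hlam hj (fun _ => notMem_of_lt_csInf') hx

theorem critSeq_succ_eq_rank_map (hj : IsElementary setLang j) {n : ℕ} {x : Level lam}
    (hx : x.1.rank = critSeq j n) : critSeq j (n + 1) = (j x).1.rank := by
  have hn : critSeq j n < lam := hx ▸ rank_lt x
  rw [critSeq, dif_pos hn]
  exact hj.rank_congr hlam ((rank_ordElem ⟨_, hn⟩).trans hx.symm)

theorem critSeq_lt (hj : j ∈ rankEmbeddings lam) (n : ℕ) : critSeq j n < lam := by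
  induction n with
  | zero => exact (isLeast_crit hlam hj).1.1
  | succ n ih =>
    rw [critSeq_succ_eq_rank_map hlam hj.1 (rank_ordElem ⟨_, ih⟩)]
    exact rank_lt _

theorem exists_rank_eq_critSeq (hj : j ∈ rankEmbeddings lam) (n : ℕ) :
    ∃ x : Level lam, x.1.rank = critSeq j n :=
  ⟨_, rank_ordElem ⟨_, critSeq_lt hlam hj n⟩⟩

theorem critSeq_strictMono (hj : j ∈ rankEmbeddings lam) : StrictMono (critSeq j) := by
  refine strictMono_nat_of_lt_succ fun n => ?_
  obtain ⟨x, hx⟩ := exists_rank_eq_critSeq hlam hj n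
  rw [critSeq_succ_eq_rank_map hlam hj.1 hx, ← hx]
  induction n generalizing x with
  | zero =>
    rw [← rank_mem_movedOrdinals_iff hlam hj.1, hx]
    exact (isLeast_crit hlam hj).1
  | succ n ih =>
    obtain ⟨y, hy⟩ := exists_rank_eq_critSeq hlam hj n
    rw [critSeq_succ_eq_rank_map hlam hj.1 hy] at hx
    rw [IsElementary.rank_congr hj.1 hlam hx, hx, IsElementary.rank_lt_iff hj.1 hlam]
    exact ih y hy

theorem rank_map_mem_Ico_critSeq (hj : j ∈ rankEmbeddings lam) {n : ℕ} {x : Level lam}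
    (hx : x.1.rank ∈ Set.Ico (critSeq j n) (critSeq j (n + 1))) :
    (j x).1.rank ∈ Set.Ico (critSeq j (n + 1)) (critSeq j (n + 2)) := by
  obtain ⟨y, hy⟩ := exists_rank_eq_critSeq hlam hj n
  obtain ⟨z, hz⟩ := exists_rank_eq_critSeq hlam hj (n + 1)
  rw [← hy, ← hz] at hx
  rw [critSeq_succ_eq_rank_map hlam hj.1 hy, critSeq_succ_eq_rank_map hlam hj.1 hz]
  exact ⟨(IsElementary.rank_le_iff hj.1 hlam y x).2 hx.1,
    (IsElementary.rank_lt_iff hj.1 hlam x z).2 hx.2⟩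

theorem isLeast_movedOrdinals_app (hj : IsElementary setLang j) (hk : k ∈ rankEmbeddings lam)
    {x : Level lam} (hx : x.1.rank = crit k) :
    IsLeast (movedOrdinals (app j k)) (j x).1.rank := by
  constructor
  · rw [rank_mem_movedOrdinals_iff hlam (hj.app hlam hk.1), app_map hlam hj hk.1,
      hj.rank_lt_iff hlam, ← rank_mem_movedOrdinals_iff hlam hk.1, hx]
    exact (isLeast_crit hlam hk).1
  · rintro α ⟨hα, hmoved⟩
    by_contra! hlt
    have fixed : app j k (ordElem ⟨α, hα⟩) = ordElem ⟨α, hα⟩ :=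
      app_eq_self hlam hj hk.1
        (fun y hy => map_eq_self_of_rank_lt_crit hlam hk.1 (hy.trans_eq hx))
        (by rwa [rank_ordElem])
    rw [ordValue, fixed, rank_ordElem] at hmoved
    exact hmoved.false

theorem app_mem_rankEmbeddings (hj : IsElementary setLang j) (hk : k ∈ rankEmbeddings lam) :
    app j k ∈ rankEmbeddings lam := by
  refine ⟨hj.app hlam hk.1, fun hid => ?_⟩
  obtain ⟨x, hx⟩ := exists_rank_eq_critSeq hlam hk 0
  have hmoved := (isLeast_movedOrdinals_app hlam hj hk hx).1
  rw [rank_mem_movedOrdinals_iff hlam (hj.app hlam hk.1), hid] at hmoved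
  exact hmoved.false

theorem critSeq_app (hj : IsElementary setLang j) (hk : k ∈ rankEmbeddings lam) {n : ℕ}
    {x : Level lam} (hx : x.1.rank = critSeq k n) :
    critSeq (app j k) n = (j x).1.rank := by
  induction n generalizing x with
  | zero =>
    exact (isLeast_crit hlam (app_mem_rankEmbeddings hlam hj hk)).unique
      (isLeast_movedOrdinals_app hlam hj hk hx)
  | succ n ih =>
    obtain ⟨y, hy⟩ := exists_rank_eq_critSeq hlam hk n
    rw [critSeq_succ_eq_rank_map hlam (hj.app hlam hk.1) (ih hy).symm, app_map hlam hj hk.1]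
    exact hj.rank_congr hlam (hx.trans (critSeq_succ_eq_rank_map hlam hk.1 hy)).symm

end CriticalSequence

section RightPowers

variable {lam : Ordinal.{u}} {j : Level lam → Level lam} (hlam : Order.IsSuccLimit lam)
  (hj : j ∈ rankEmbeddings lam)

include hlam hj

theorem rightPower_mem_rankEmbeddings (n : ℕ) : rightPower j n ∈ rankEmbeddings lam := by
  induction n with
  | zero => exact hj
  | succ n ih => exact app_mem_rankEmbeddings hlam ih.1 ih

theorem critSeq_rightPower (n m : ℕ) : critSeq (rightPower j n) m = critSeq j (n + m) := by
  induction n generalizing m with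
  | zero => rw [rightPower, zero_add]
  | succ n ih =>
    have hn := rightPower_mem_rankEmbeddings hlam hj n
    obtain ⟨x, hx⟩ := exists_rank_eq_critSeq hlam hn m
    rw [rightPower, critSeq_app hlam hn.1 hn hx, ← critSeq_succ_eq_rank_map hlam hn.1 hx, ih,
      Nat.succ_add_eq_add_succ]

theorem crit_rightPower (n : ℕ) : crit (rightPower j n) = critSeq j n :=
  critSeq_rightPower hlam hj n 0

theorem rightPower_eq_self {n m : ℕ} (hnm : n ≤ m) {x : Level lam} (hx : x.1.rank < critSeq j n) :
    rightPower j m x = x := by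
  refine map_eq_self_of_rank_lt_crit hlam (rightPower_mem_rankEmbeddings hlam hj m).1 ?_
  rw [crit_rightPower hlam hj]
  exact hx.trans_le ((critSeq_strictMono hlam hj).monotone hnm)

theorem rank_rightPower_mem_Ico_critSeq {n m : ℕ} (hnm : n ≤ m) {x : Level lam}
    (hx : x.1.rank ∈ Set.Ico (critSeq j m) (critSeq j (m + 1))) :
    (rightPower j n x).1.rank ∈ Set.Ico (critSeq j (m + 1)) (critSeq j (m + 2)) := by
  obtain ⟨d, rfl⟩ := Nat.exists_eq_add_of_le hnm
  have := rank_map_mem_Ico_critSeq hlam (rightPower_mem_rankEmbeddings hlam hj n) (n := d) (x := x)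
  simp only [critSeq_rightPower hlam hj] at this
  exact this hx

theorem rank_composite_rightPower_mem_Ico_critSeq {n m : ℕ} (hnm : n ≤ m) {x : Level lam}
    (hx : x.1.rank ∈ Set.Ico (critSeq j m) (critSeq j (m + 1))) :
    (composite (rightPower j) n x).1.rank ∈
      Set.Ico (critSeq j (m + n + 1)) (critSeq j (m + n + 2)) := by
  induction n generalizing m x with
  | zero => exact rank_rightPower_mem_Ico_critSeq hlam hj hnm hx
  | succ n ih =>
    have := ih (n.le_succ.trans (hnm.trans m.le_succ))
      (rank_rightPower_mem_Ico_critSeq hlam hj hnm hx)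
    rwa [Nat.succ_add_eq_add_succ] at this

end RightPowers

section InverseLimit

variable {lam : Ordinal.{u}}

theorem inverseLimit_eq_composite {k : ℕ → Level lam → Level lam} {a : LimitDomain k} {n : ℕ}
    (hn : ∀ m > n, k m a.1 = a.1) : inverseLimit k a = composite k n a.1 := by
  let s := {n : ℕ | ∀ m > n, k m a.1 = a.1}
  have fixed : ∀ m > sInf s, k m a.1 = a.1 := Nat.sInf_mem (s := s) ⟨n, hn⟩
  suffices ∀ n ≥ sInf s, composite k n a.1 = composite k (sInf s) a.1 from
    (this n (Nat.sInf_le hn)).symm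
  intro n hle
  induction n, hle using Nat.le_induction with
  | base => rfl
  | succ n hle ih =>
    rw [composite, Function.comp_apply, fixed (n + 1) (Nat.lt_succ_of_le hle), ih]

variable {j : Level lam → Level lam} (hlam : Order.IsSuccLimit lam) (hj : j ∈ rankEmbeddings lam)

include hlam hj

theorem exists_rank_lt_critSeq (a : LimitDomain (rightPower j)) :
    ∃ n, a.1.1.rank < critSeq j n := by
  have h := ZFSet.mem_vonNeumann.1 a.2
  simp only [limitHeight, crit_rightPower hlam hj] at h
  exact (Filter.eventually_lt_of_lt_liminf h).exists

theorem rank_inverseLimit_rightPower_mem (a : LimitDomain (rightPower j)) :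
    (inverseLimit (rightPower j) a).1.rank ∈ Set.Iio (critSeq j 0) ∪
      ⋃ n : ℕ, Set.Ico (critSeq j (2 * n + 1)) (critSeq j (2 * n + 2)) := by
  obtain ⟨n, hn⟩ := exists_rank_lt_critSeq hlam hj a
  induction n with
  | zero =>
    have fixed (m : ℕ) := rightPower_eq_self hlam hj m.zero_le hn
    rw [inverseLimit_eq_composite fun m (_ : m > 0) => fixed m, composite, fixed]
    exact Or.inl hn
  | succ n ih =>
    by_cases hlt : a.1.1.rank < critSeq j n
    · exact ih hlt
    · rw [inverseLimit_eq_composite fun m hm => rightPower_eq_self hlam hj hm hn]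
      refine Or.inr (Set.mem_iUnion.2 ⟨n, ?_⟩)
      rw [two_mul]
      exact rank_composite_rightPower_mem_Ico_critSeq hlam hj le_rfl ⟨not_lt.1 hlt, hn⟩

end InverseLimit

end RankToRank

open RankToRank in
theorem proposition17 (lam : Ordinal.{u}) (hlam : Order.IsSuccLimit lam)
    (j : Level lam → Level lam) (hj : j ∈ rankEmbeddings lam) :
    -- the critical points, the critical sequence, the right powers and `k` are well defined
    ((∀ n, IsLeast (movedOrdinals (rightPower j n)) (crit (rightPower j n))) ∧
      (∀ n, critSeq j n < lam) ∧
      (∀ n, graph (rightPower j (n + 1)) = extend (rightPower j n) (graph (rightPower j n))) ∧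
      (∀ a : LimitDomain (rightPower j), ∃ n, ∀ m > n, rightPower j m a.1 = a.1)) ∧
    -- the ordinals below `lam` in the range of `k = j ∘ j^(1) ∘ j^(2) ∘ ⋯`
    {α : Ordinal.{u} | α < lam ∧ ∃ a, (inverseLimit (rightPower j) a).1 = α.toZFSet} ⊆
      Set.Iio (critSeq j 0) ∪
        ⋃ n : ℕ, Set.Ico (critSeq j (2 * n + 1)) (critSeq j (2 * n + 2)) := by
  have hpow := rightPower_mem_rankEmbeddings hlam hj
  refine ⟨⟨fun n => isLeast_crit hlam (hpow n), critSeq_lt hlam hj,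
    fun n => graph_app hlam (hpow n).1 (hpow n).1, fun a => ?_⟩, ?_⟩
  · obtain ⟨n, hn⟩ := exists_rank_lt_critSeq hlam hj a
    exact ⟨n, fun m hm => rightPower_eq_self hlam hj hm.le hn⟩
  · rintro α ⟨-, a, ha⟩
    rw [← Ordinal.rank_toZFSet α, ← ha]
    exact rank_inverseLimit_rightPower_mem hlam hj a
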